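/- Let $\Gamma\subset\mathbb{R}^m\times\mathbb{R}$ be a lattice such that the two coordinate projections $p_1:\mathbb{R}^m\times\mathbb{R}\to\mathbb{R}^m$ and $p_2:\mathbb{R}^m\times\mathbb{R}\to\mathbb{R}$ are injective on $\Gamma$ and have dense images $p_1(\Gamma)$, $p_2(\Gamma)$. Let $\Omega\subset\mathbb{R}$ be a nonempty compact interval that equals the closure of its interior, is symmetric around the origin, and whose boundary contains no point of $p_2(\Gamma)$. Let $\Lambda(\Omega)=\{p_1(\gamma):\gamma\in\Gamma,\ p_2(\gamma)\in\Omega\}$ be the corresponding (simple generic) model set. Let $\Delta\subset\mathbb{R}^m$ be relatively dense and uniformly discrete, and let $g_1,\dots,g_L\in W(L^2,\ell^1)$, i.e. $\sum_{k\in\mathbb{Z}^m}\|g_l\mathbf 1_{k+[0,1]^m}\|_2<\infty$ for each $l$. Consider the Gabor system $$\mathcal G(g,\Lambda(\Omega),\Delta)=\{T_\lambda M_\beta g_l : l=1,\dots,L,\ \lambda\in\Lambda(\Omega),\ \beta\in\Delta\},$$ where $T_\lambda f(t)=f(t-\lambda)$ and $M_\beta f(t)=e^{2\pi i\beta\cdot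 t}f(t)$, and let $\widehat f(\omega)=\int_{\mathbb{R}^m}f(t)e^{-2\pi i t\cdot\omega}\,dt$. Then the density $$D(\Lambda(\Omega))=\lim_{R\to\infty}\frac{\#\big(\Lambda(\Omega)\cap(x+R[0,1]^m)\big)}{R^m}$$ exists and does not depend on $x\in\mathbb{R}^m$, and $\mathcal G(g,\Lambda(\Omega),\Delta)$ is a normalized tight frame for $L^2(\mathbb{R}^m)$ (a frame with lower and upper frame bounds both equal to $1$) if and only if it is a Bessel sequence with upper frame bound $1$, that is, $$\sum_{l=1}^L\sum_{\lambda\in\Lambda(\Omega)}\sum_{\beta\in\Delta}|\langle f,T_\lambda M_\beta g_l\rangle|^2\le\|f\|_2^2\quad\text{for all } f\in L^2(\mathbb{R}^m),$$ and $$D(\Lambda(\Omega))\sum_{l=1}^L\sum_{\beta\in\Delta}|\widehat{g}_l(t-\beta)|^2=1\quad\text{for a.e. } t\in\mathbb{R}^m.$$ -/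

import Mathlib

open MeasureTheory Filter Topology
open scoped ENNReal NNReal FourierTransform Pointwise

noncomputable section

namespace GaborModelSet

/-! ### Geometry of point sets in `ℝ^m` -/

/-- The cube `B(x, R) = x + R • [0, 1]^m`. -/
def cube {m : ℕ} (x : EuclideanSpace ℝ (Fin m)) (R : ℝ) : Set (EuclideanSpace ℝ (Fin m)) :=
  {t | ∀ i, x i ≤ t i ∧ t i ≤ x i + R}

/-- `S` is relatively dense: for some `r > 0`, every cube of side `r` meets `S`. -/
def IsRelativelyDense {m : ℕ} (S : Set (EuclideanSpace ℝ (Fin m))) : Prop :=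
  ∃ r : ℝ, 0 < r ∧ ∀ t, (S ∩ cube t r).Nonempty

/-- `S` is uniformly discrete: for some `r > 0`, distinct points of `S` have distance at
least `r`. -/
def IsUniformlyDiscrete {m : ℕ} (S : Set (EuclideanSpace ℝ (Fin m))) : Prop :=
  ∃ r : ℝ, 0 < r ∧ ∀ x ∈ S, ∀ y ∈ S, dist x y < r → x = y

/-- `S` has density `d`: for every `x`, `#(S ∩ B(x, R)) / R^m → d` as `R → ∞`. -/
def HasDensity {m : ℕ} (S : Set (EuclideanSpace ℝ (Fin m))) (d : ℝ) : Prop :=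
  ∀ x, Tendsto (fun R : ℝ => ((S ∩ cube x R).ncard : ℝ) / R ^ m) atTop (𝓝 d)

/-- The density `D(S)`, as the limit of `#(S ∩ B(0, R)) / R^m`; meaningful when `S` has a
density in the sense of `HasDensity`. -/
def density {m : ℕ} (S : Set (EuclideanSpace ℝ (Fin m))) : ℝ :=
  limUnder atTop (fun R : ℝ => ((S ∩ cube 0 R).ncard : ℝ) / R ^ m)

/-! ### Model sets -/

/-- The model set `{p₁ γ : γ ∈ Γ, p₂ γ ∈ Ω}`. -/
def modelSet {E H : Type*} [AddCommGroup E] [AddCommGroup H]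
    (Γ : Submodule ℤ (E × H)) (Ω : Set H) : Set E :=
  {x | ∃ γ ∈ Γ, γ.1 = x ∧ γ.2 ∈ Ω}

/-- Both projections are injective on `Γ` and have dense image. -/
structure IsCutAndProject {E H : Type*} [AddCommGroup E] [AddCommGroup H]
    [TopologicalSpace E] [TopologicalSpace H] (Γ : Submodule ℤ (E × H)) : Prop where
  injOn_fst : Set.InjOn Prod.fst (Γ : Set (E × H))
  dense_fst : Dense (Prod.fst '' (Γ : Set (E × H)))
  injOn_snd : Set.InjOn Prod.snd (Γ : Set (E × H))
  dense_snd : Dense (Prod.snd '' (Γ : Set (E × H)))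

/-- A window: a nonempty compact set that is the closure of its interior and has a boundary of
measure zero. -/
structure IsWindow {H : Type*} [TopologicalSpace H] [MeasureSpace H] (Ω : Set H) : Prop where
  nonempty : Ω.Nonempty
  isCompact : IsCompact Ω
  closure_interior : closure (interior Ω) = Ω
  volume_frontier : volume (frontier Ω) = 0

/-- The data of a simple (one-dimensional internal space, interval as window) generic
(no point of `p₂(Γ)` on the boundary of the window) model set whose window is symmetric around
the origin. -/
structure IsSimpleGenericSymmetric {m : ℕ} (Γ : Submodule ℤ (EuclideanSpace ℝ (Fin m) × ℝ))
    (Ω : Set ℝ) : Prop where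
  isCutAndProject : IsCutAndProject Γ
  isWindow : IsWindow Ω
  interval : Ω.OrdConnected
  symmetric : -Ω = Ω
  generic : Disjoint (frontier Ω) (Prod.snd '' (Γ : Set (EuclideanSpace ℝ (Fin m) × ℝ)))

/-! ### The amalgam space `W(L^p, ℓ^1)` -/

/-- The point of `ℝ^m` with integer coordinates `k`. -/
def intVec {m : ℕ} (k : Fin m → ℤ) : EuclideanSpace ℝ (Fin m) :=
  WithLp.toLp 2 fun i => (k i : ℝ)

/-- The norm of `W(L^p, ℓ^1)`: the sum over `k ∈ ℤ^m` of the `L^p` norms of the restrictions of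
`f` to the cubes `[0, 1]^m + k`. -/
def amalgamNorm {m : ℕ} (p : ℝ≥0∞) (f : EuclideanSpace ℝ (Fin m) → ℂ) : ℝ≥0∞ :=
  ∑' k : Fin m → ℤ, eLpNorm ((cube (intVec k) 1).indicator f) p volume

/-- Membership in `W(L^p, ℓ^1)`. -/
def MemAmalgam {m : ℕ} (p : ℝ≥0∞) (f : EuclideanSpace ℝ (Fin m) → ℂ) : Prop :=
  AEStronglyMeasurable f volume ∧ amalgamNorm p f < ∞

/-! ### Translations, modulations and Gabor systems -/

/-- The Hilbert space `L²(ℝ^m)`. -/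
abbrev L2 (m : ℕ) : Type := Lp ℂ 2 (volume : Measure (EuclideanSpace ℝ (Fin m)))

/-- Translation on `L²(ℝ^m)`: `(T_x f)(t) = f (t - x)`. -/
def translateL2 {m : ℕ} (x : EuclideanSpace ℝ (Fin m)) (f : L2 m) : L2 m :=
  Lp.compMeasurePreserving (fun t => t - x) (measurePreserving_sub_right volume x) f

theorem memLp_modulate {m : ℕ} (b : EuclideanSpace ℝ (Fin m)) (f : L2 m) :
    MemLp (fun t => Complex.exp (2 * Real.pi * Complex.I * (inner ℝ b t : ℝ)) * f t) 2
      (volume : Measure (EuclideanSpace ℝ (Fin m))) := by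
  refine (Lp.memLp f).of_le ?_ ?_
  · refine AEStronglyMeasurable.mul ?_ (Lp.aestronglyMeasurable f)
    exact Continuous.aestronglyMeasurable (by fun_prop)
  · refine Eventually.of_forall fun t => le_of_eq ?_
    have h : (2 * Real.pi * Complex.I * (inner ℝ b t : ℝ) : ℂ)
        = ((2 * Real.pi * inner ℝ b t : ℝ) : ℂ) * Complex.I := by
      push_cast
      ring
    rw [norm_mul, h, Complex.norm_exp_ofReal_mul_I, one_mul]

/-- Modulation on `L²(ℝ^m)`: `(M_b f)(t) = exp (2 π i b · t) f t`. -/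
def modulateL2 {m : ℕ} (b : EuclideanSpace ℝ (Fin m)) (f : L2 m) : L2 m :=
  (memLp_modulate b f).toLp _

/-- The Gabor system `G(g, S, Δ) = (T_x M_b g_l)`, indexed by `l`, `x ∈ S`, `b ∈ Δ`. -/
def gaborSystem {m L : ℕ} (g : Fin L → L2 m) (S Δ : Set (EuclideanSpace ℝ (Fin m))) :
    Fin L × S × Δ → L2 m :=
  fun i => translateL2 (i.2.1 : EuclideanSpace ℝ (Fin m))
    (modulateL2 (i.2.2 : EuclideanSpace ℝ (Fin m)) (g i.1))

/-! ### Frames -/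

section Frames

variable {ι V : Type*} [NormedAddCommGroup V] [InnerProductSpace ℂ V]

/-- The sum `∑ i, |⟨f, e i⟩|²`, with values in `[0, ∞]`. -/
def frameSum (e : ι → V) (f : V) : ℝ≥0∞ := ∑' i, ‖inner ℂ (e i) f‖ₑ ^ 2

/-- `e` is a Bessel sequence with upper frame bound `B`. -/
def IsBesselWith (B : ℝ≥0) (e : ι → V) : Prop :=
  ∀ f : V, frameSum e f ≤ B * ‖f‖ₑ ^ 2

/-- `e` is a frame with lower frame bound `A` and upper frame bound `B`. -/
def IsFrameWith (A B : ℝ≥0) (e : ι → V) : Prop :=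
  0 < A ∧ 0 < B ∧ ∀ f : V, A * ‖f‖ₑ ^ 2 ≤ frameSum e f ∧ frameSum e f ≤ B * ‖f‖ₑ ^ 2

/-- A normalized tight frame: a frame with both bounds equal to `1`. -/
def IsNormalizedTightFrame (e : ι → V) : Prop := IsFrameWith 1 1 e

end Frames

end GaborModelSet

end

/-!
For `f` in `L²` let `φ x` be the frame sum of `f` over the generators translated by `x`. The frame
sum of `T_x f` over all translates along the model set is `F x = ∑ φ (y - x)`, `y ∈ Λ(Ω)`. It
extends to a function of `(x, w)`, with `w` moving the window, which is invariant under `Γ`.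
Unfolding its integral over a fundamental domain shows that its mean is `D(Λ(Ω)) ∫ φ`, and by
Plancherel this is the integral of `|𝓕 f|²` against the weight `D(Λ(Ω)) ∑ |𝓕 h_i|²`, where `h_i` are
the generators. A Bessel bound gives `F ≤ ‖f‖²`, so `F` equals `‖f‖²` almost everywhere if and only
if its mean does; this holds for all `f` exactly when the weight is `1` almost everywhere. Since `F`
is continuous in `x`, equality almost everywhere includes `x = 0`.

The density itself comes from comparison: `Γ` is cocompact and `p₂(Γ)` is dense, so points of `Γ`
approximate any `(x, w)` with bounded error in `x` and arbitrarily small error in `w`. Hence the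
count in a cube lies between the means for slightly smaller and slightly larger cubes and windows.
-/

namespace GaborModelSet

/-! ### Averages over the lattice -/

section Periodization

variable {V : Type*} [AddCommGroup V] [MeasurableSpace V] [MeasurableAdd V]
  {Γ : Submodule ℤ V} [Countable Γ] {μ : Measure V} [μ.IsAddLeftInvariant] {D : Set V}

theorem setLIntegral_tsum_sub [MeasurableNeg V] [μ.IsNegInvariant]
    (hD : IsAddFundamentalDomain Γ D μ) {ψ : V → ℝ≥0∞} (hψ : Measurable ψ) :
    ∫⁻ v in D, ∑' γ : Γ, ψ (γ - v) ∂μ = ∫⁻ v, ψ v ∂μ := by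
  have : MeasurableVAdd Γ V := (inferInstance : MeasurableVAdd Γ.toAddSubgroup V)
  have : VAddInvariantMeasure Γ V μ := (inferInstance : VAddInvariantMeasure Γ.toAddSubgroup V μ)
  rw [← lintegral_neg_eq_self ψ, hD.lintegral_eq_tsum', lintegral_tsum fun γ => by fun_prop]
  simp only [Submodule.vadd_def, vadd_eq_add, Submodule.coe_neg, neg_add_eq_sub, neg_sub]

theorem ae_eq_const_of_setLIntegral_eq (hD : IsAddFundamentalDomain Γ D μ) (hDtop : μ D ≠ ∞)
    {F : V → ℝ≥0∞} (hF : ∀ (γ : Γ) v, F (γ + v) = F v) {c : ℝ≥0∞} (hc : c ≠ ∞)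
    (hle : ∀ v, F v ≤ c) (hint : ∫⁻ v in D, F v ∂μ = c * μ D) : ∀ᵐ v ∂μ, F v = c := by
  have : MeasurableVAdd Γ V := (inferInstance : MeasurableVAdd Γ.toAddSubgroup V)
  have : VAddInvariantMeasure Γ V μ := (inferInstance : VAddInvariantMeasure Γ.toAddSubgroup V μ)
  have hae : ∀ᵐ v ∂μ.restrict D, F v = c := by
    refine ae_eq_of_ae_le_of_lintegral_le (Eventually.of_forall hle) ?_ aemeasurable_const ?_
    · exact hint ▸ ENNReal.mul_ne_top hc hDtop
    · rw [setLIntegral_const, hint]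
  refine hD.measure_zero_of_invariant {v | ¬ F v = c} (fun γ => ?_) ?_
  · ext v
    have := hF (-γ) v
    simp_all [Set.mem_vadd_set_iff_neg_vadd_mem, Submodule.vadd_def]
  · rwa [ae_iff, Measure.restrict_apply₀' hD.nullMeasurableSet] at hae

end Periodization

section Semicontinuity

variable {H : Type*} [AddCommGroup H] [TopologicalSpace H] [IsTopologicalAddGroup H]
  [MeasurableSpace H]

theorem lowerSemicontinuous_measure_vadd (μ : Measure H) [μ.Regular] {U : Set H} (hU : IsOpen U) :
    LowerSemicontinuous fun w : H => μ (w +ᵥ U) := by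
  intro w r hr
  obtain ⟨K, hKU, hK, hrK⟩ := (hU.vadd w).exists_lt_isCompact hr
  have hsub : ∀ᶠ w' in 𝓝 w, ∀ y ∈ K, -w' + y ∈ U :=
    hK.eventually_forall_of_forall_eventually fun y hy =>
      (by fun_prop : Continuous fun z : H × H => -z.1 + z.2).continuousAt.eventually_mem
        (hU.mem_nhds (Set.mem_vadd_set_iff_neg_vadd_mem.1 (hKU hy)))
  filter_upwards [hsub] with w' hw'
  exact hrK.trans_le (measure_mono fun y hy => Set.mem_vadd_set_iff_neg_vadd_mem.2 (hw' y hy))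

theorem upperSemicontinuous_measure_vadd (μ : Measure H) [μ.OuterRegular] {K : Set H}
    (hK : IsCompact K) : UpperSemicontinuous fun w : H => μ (w +ᵥ K) := by
  intro w r hr
  obtain ⟨U, hKU, hU, hUr⟩ := Set.exists_isOpen_lt_of_lt _ _ hr
  have hsub : ∀ᶠ w' in 𝓝 w, ∀ y ∈ K, w' + y ∈ U :=
    hK.eventually_forall_of_forall_eventually fun y hy =>
      continuous_add.continuousAt.eventually_mem (hU.mem_nhds (hKU (Set.vadd_mem_vadd_set hy)))
  filter_upwards [hsub] with w' hw'
  refine (measure_mono ?_).trans_lt hUr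
  rintro _ ⟨y, hy, rfl⟩
  exact hw' y hy

theorem measure_vadd_le_of_dense (μ : Measure H) [μ.Regular] {U : Set H} (hU : IsOpen U)
    {s : Set H} (hs : Dense s) {c : ℝ≥0∞} (hle : ∀ w ∈ s, μ (w +ᵥ U) ≤ c) (w : H) :
    μ (w +ᵥ U) ≤ c :=
  ((lowerSemicontinuous_measure_vadd μ hU).isClosed_preimage c).closure_subset_iff.2 hle (hs w)

theorem le_measure_vadd_of_dense (μ : Measure H) [μ.OuterRegular] {K : Set H} (hK : IsCompact K)
    {s : Set H} (hs : Dense s) {c : ℝ≥0∞} (hle : ∀ w ∈ s, c ≤ μ (w +ᵥ K)) (w : H) :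
    c ≤ μ (w +ᵥ K) :=
  ((upperSemicontinuous_measure_vadd μ hK).isClosed_preimage c).closure_subset_iff.2 hle (hs w)

end Semicontinuity

section InternalMeasure

variable {E H : Type*} [AddCommGroup E] [AddCommGroup H] [MeasurableSpace H]

/-- The measure on the internal space `H` that puts mass `φ (γ.1 - x)` at `γ.2`, for each `γ ∈ Γ`.
The mass of a window `Ω` is the sum of `φ (· - x)` over the model set of `Ω`, while moving the
window and moving `x` by the two components of an element of `Γ` amount to the same. -/
noncomputable def internalMeasure (Γ : Submodule ℤ (E × H)) (φ : E → ℝ≥0∞) (x : E) : Measure H :=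
  Measure.sum fun γ : Γ => φ ((γ : E × H).1 - x) • Measure.dirac (γ : E × H).2

variable [MeasurableSingletonClass H] {Γ : Submodule ℤ (E × H)} [Countable Γ]
  {φ : E → ℝ≥0∞} {x : E} {w : H} {S : Set H}

theorem internalMeasure_vadd :
    internalMeasure Γ φ x (w +ᵥ S) =
      ∑' γ : Γ, φ ((γ : E × H) - (x, w)).1 * S.indicator 1 ((γ : E × H) - (x, w)).2 := by
  rw [internalMeasure, Measure.sum_apply_of_countable]
  refine tsum_congr fun γ => ?_
  have hmem : (γ : E × H).2 ∈ w +ᵥ S ↔ ((γ : E × H) - (x, w)).2 ∈ S := by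
    rw [Set.mem_vadd_set_iff_neg_vadd_mem, vadd_eq_add, neg_add_eq_sub, Prod.snd_sub]
  rw [Measure.smul_apply, Measure.dirac_apply, smul_eq_mul, Prod.fst_sub]
  exact congrArg _ (Set.indicator_eq_indicator hmem rfl)

theorem internalMeasure_add_vadd (γ : Γ) :
    internalMeasure Γ φ ((γ : E × H).1 + x) (((γ : E × H).2 + w) +ᵥ S) =
      internalMeasure Γ φ x (w +ᵥ S) := by
  rw [internalMeasure_vadd, internalMeasure_vadd, ← (Equiv.addLeft γ).tsum_eq]
  simp only [Equiv.coe_addLeft, Submodule.coe_add, Prod.fst_sub, Prod.snd_sub, Prod.fst_add,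
    Prod.snd_add, add_sub_add_left_eq_sub]

theorem internalMeasure_snd_vadd (γ : Γ) :
    internalMeasure Γ φ x ((γ : E × H).2 +ᵥ S) = internalMeasure Γ φ (x - (γ : E × H).1) S := by
  simpa using internalMeasure_add_vadd (φ := φ) (x := x - (γ : E × H).1) (w := 0) (S := S) γ

theorem internalMeasure_eq_tsum_modelSet (hΓ : Set.InjOn Prod.fst (Γ : Set (E × H))) :
    internalMeasure Γ φ x S = ∑' y : modelSet Γ S, φ (y - x) := by
  have himg : modelSet Γ S = (fun γ : Γ => (γ : E × H).1) '' {γ | (γ : E × H).2 ∈ S} := by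
    ext y
    simp [modelSet, and_assoc, and_comm]
  have hinj : Function.Injective fun γ : Γ => (γ : E × H).1 := fun γ δ h =>
    Subtype.ext (hΓ γ.2 δ.2 h)
  rw [himg, tsum_image (fun y => φ (y - x)) hinj.injOn,
    tsum_subtype {γ : Γ | (γ : E × H).2 ∈ S} fun γ => φ ((γ : E × H).1 - x), ← zero_vadd H S,
    internalMeasure_vadd]
  refine tsum_congr fun γ => ?_
  by_cases hγ : (γ : E × H).2 ∈ S <;> simp [hγ]

section BoundedMass

variable [TopologicalSpace H] [IsTopologicalAddGroup H] {c : ℝ≥0∞}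

theorem isLocallyFiniteMeasure_internalMeasure (hdense : Dense (Prod.snd '' (Γ : Set (E × H))))
    (hS : (interior S).Nonempty) (hc : c ≠ ∞) (hle : ∀ x, internalMeasure Γ φ x S ≤ c) (x : E) :
    IsLocallyFiniteMeasure (internalMeasure Γ φ x) := by
  refine ⟨fun w => ?_⟩
  obtain ⟨v, hv⟩ := hS
  have hU : IsOpen {u : H | -u + w ∈ interior S} := isOpen_interior.preimage (by fun_prop)
  obtain ⟨_, hw, γ, hγ, rfl⟩ := hdense.inter_open_nonempty _ hU ⟨w - v, by simpa using hv⟩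
  refine ⟨γ.2 +ᵥ interior S,
    (isOpen_interior.vadd γ.2).mem_nhds (Set.mem_vadd_set_iff_neg_vadd_mem.2 hw), ?_⟩
  calc internalMeasure Γ φ x (γ.2 +ᵥ interior S)
      ≤ internalMeasure Γ φ x (γ.2 +ᵥ S) := measure_mono (Set.vadd_set_mono interior_subset)
    _ = internalMeasure Γ φ (x - γ.1) S := internalMeasure_snd_vadd ⟨γ, hγ⟩
    _ < ∞ := (hle _).trans_lt hc.lt_top

theorem internalMeasure_vadd_interior_le (hdense : Dense (Prod.snd '' (Γ : Set (E × H))))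
    (hle : ∀ x, internalMeasure Γ φ x S ≤ c) (x : E) [(internalMeasure Γ φ x).Regular] (w : H) :
    internalMeasure Γ φ x (w +ᵥ interior S) ≤ c := by
  refine measure_vadd_le_of_dense _ isOpen_interior hdense ?_ w
  rintro _ ⟨γ, hγ, rfl⟩
  calc internalMeasure Γ φ x (γ.2 +ᵥ interior S)
      ≤ internalMeasure Γ φ x (γ.2 +ᵥ S) := measure_mono (Set.vadd_set_mono interior_subset)
    _ = internalMeasure Γ φ (x - γ.1) S := internalMeasure_snd_vadd ⟨γ, hγ⟩
    _ ≤ c := hle _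

theorem ae_le_internalMeasure_vadd [TopologicalSpace E] [IsTopologicalAddGroup E]
    [MeasurableSpace E] [BorelSpace E] {μ : Measure E} [μ.IsAddRightInvariant]
    (hdense : Dense (Prod.snd '' (Γ : Set (E × H)))) (hS : IsCompact S)
    (hreg : ∀ x, (internalMeasure Γ φ x).OuterRegular)
    (hle : ∀ᵐ x ∂μ, c ≤ internalMeasure Γ φ x S) :
    ∀ᵐ x ∂μ, ∀ w : H, c ≤ internalMeasure Γ φ x (w +ᵥ S) := by
  have hshift : ∀ᵐ x ∂μ, ∀ γ : Γ, c ≤ internalMeasure Γ φ (x - (γ : E × H).1) S :=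
    ae_all_iff.2 fun γ =>
      (measurePreserving_sub_right μ (γ : E × H).1).quasiMeasurePreserving.ae hle
  filter_upwards [hshift] with x hx
  refine le_measure_vadd_of_dense _ hS hdense ?_
  rintro _ ⟨γ, hγ, rfl⟩
  exact (hx ⟨γ, hγ⟩).trans_eq (internalMeasure_snd_vadd ⟨γ, hγ⟩).symm

end BoundedMass

end InternalMeasure

section MeanValue

variable {E H : Type*} [NormedAddCommGroup E] [NormedSpace ℝ E] [FiniteDimensional ℝ E]
  [MeasurableSpace E] [BorelSpace E] [NormedAddCommGroup H] [NormedSpace ℝ H]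
  [FiniteDimensional ℝ H] [MeasurableSpace H] [BorelSpace H]
  {Γ : Submodule ℤ (E × H)} [Countable Γ] {φ : E → ℝ≥0∞} {Ω : Set H} {c : ℝ≥0∞}
  {μ : Measure E} [μ.IsAddHaarMeasure] {ν : Measure H} [ν.IsAddHaarMeasure] {D : Set (E × H)}

theorem setLIntegral_internalMeasure (hD : IsAddFundamentalDomain Γ D (μ.prod ν))
    (hφ : Measurable φ) {S : Set H} (hS : MeasurableSet S) :
    ∫⁻ v in D, internalMeasure Γ φ v.1 (v.2 +ᵥ S) ∂(μ.prod ν) = (∫⁻ x, φ x ∂μ) * ν S := by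
  -- The instance search for `IsNegInvariant` does not find regularity by itself.
  have : (μ.prod ν).Regular := inferInstance
  simp_rw [internalMeasure_vadd, Prod.mk.eta]
  rw [setLIntegral_tsum_sub hD (ψ := fun u => φ u.1 * S.indicator 1 u.2)
    ((hφ.comp measurable_fst).mul ((measurable_one.indicator hS).comp measurable_snd)),
    lintegral_prod_mul hφ.aemeasurable (measurable_one.indicator hS).aemeasurable,
    lintegral_indicator_one hS]

-- Invariance under `Γ` spreads a bound that holds at the window `Ω` over a dense set of translates
-- `w +ᵥ Ω`; semicontinuity in `w` extends it to all `w`, from above for `interior Ω` and from below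
-- for `Ω` itself.
theorem ae_internalMeasure_eq_iff (hdense : Dense (Prod.snd '' (Γ : Set (E × H))))
    (hΩ : IsCompact Ω) (hΩint : (interior Ω).Nonempty) (hΩν : ν (frontier Ω) = 0)
    (hD : IsAddFundamentalDomain Γ D (μ.prod ν)) (hDtop : μ.prod ν D ≠ ∞) (hφ : Measurable φ)
    (hc : c ≠ ∞) (hle : ∀ x, internalMeasure Γ φ x Ω ≤ c) :
    (∀ᵐ x ∂μ, internalMeasure Γ φ x Ω = c) ↔ (∫⁻ x, φ x ∂μ) * ν Ω = c * μ.prod ν D := by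
  have hfin := isLocallyFiniteMeasure_internalMeasure hdense hΩint hc hle
  have hint_le := fun v : E × H => internalMeasure_vadd_interior_le hdense hle v.1 v.2
  have hint : ∫⁻ v in D, internalMeasure Γ φ v.1 (v.2 +ᵥ interior Ω) ∂(μ.prod ν) =
      (∫⁻ x, φ x ∂μ) * ν Ω := by
    rw [setLIntegral_internalMeasure hD hφ measurableSet_interior,
      measure_congr (interior_ae_eq_of_null_frontier hΩν)]
  constructor <;> intro h
  · have hge := ae_le_internalMeasure_vadd hdense hΩ (fun _ => inferInstance)
      (h.mono fun _ hx => hx.ge)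
    apply le_antisymm
    · calc (∫⁻ x, φ x ∂μ) * ν Ω
          = ∫⁻ v in D, internalMeasure Γ φ v.1 (v.2 +ᵥ interior Ω) ∂(μ.prod ν) := hint.symm
        _ ≤ ∫⁻ _ in D, c ∂(μ.prod ν) := lintegral_mono hint_le
        _ = c * μ.prod ν D := setLIntegral_const _ _
    · calc c * μ.prod ν D = ∫⁻ _ in D, c ∂(μ.prod ν) := (setLIntegral_const _ _).symm
        _ ≤ ∫⁻ v in D, internalMeasure Γ φ v.1 (v.2 +ᵥ Ω) ∂(μ.prod ν) := by
          refine lintegral_mono_ae (ae_restrict_of_ae ?_)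
          filter_upwards [Measure.quasiMeasurePreserving_fst.ae hge] with v hv using hv v.2
        _ = (∫⁻ x, φ x ∂μ) * ν Ω := setLIntegral_internalMeasure hD hφ hΩ.measurableSet
  · have hae : ∀ᵐ v ∂μ.prod ν, internalMeasure Γ φ v.1 (v.2 +ᵥ interior Ω) = c :=
      ae_eq_const_of_setLIntegral_eq hD hDtop (fun γ _ => internalMeasure_add_vadd γ) hc
        hint_le (hint.trans h)
    filter_upwards [Measure.ae_ae_of_ae_prod hae] with x hx
    have hge : c ≤ internalMeasure Γ φ x ((0 : H) +ᵥ Ω) := by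
      refine le_measure_vadd_of_dense _ hΩ (Measure.dense_of_ae hx) (fun w hw => ?_) 0
      rw [← show _ = c from hw]
      exact measure_mono (Set.vadd_set_mono interior_subset)
    exact (hle x).antisymm (by rwa [zero_vadd] at hge)

end MeanValue

/-! ### Density of model sets -/

section Lattice

variable {V : Type*} [NormedAddCommGroup V] [NormedSpace ℝ V] [FiniteDimensional ℝ V]
  (Γ : Submodule ℤ V) [DiscreteTopology Γ] [IsZLattice ℝ Γ]

theorem exists_isAddFundamentalDomain [MeasurableSpace V] [BorelSpace V] (μ : Measure V)
    [μ.IsAddHaarMeasure] :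
    ∃ D, IsAddFundamentalDomain Γ D μ ∧ μ D = ENNReal.ofReal (ZLattice.covolume Γ μ) := by
  have : Module.Finite ℤ Γ := ZLattice.module_finite ℝ Γ
  have : Module.Free ℤ Γ := ZLattice.module_free ℝ Γ
  let b := Module.Free.chooseBasis ℤ Γ
  have hD := ZLattice.isAddFundamentalDomain b μ
  refine ⟨_, hD, ?_⟩
  rw [ZLattice.covolume_eq_measure_fundamentalDomain Γ μ hD, ofReal_measureReal
    (ZSpan.fundamentalDomain_isBounded _).measure_lt_top.ne]

theorem exists_isCompact_forall_exists_sub_mem : ∃ K : Set V, IsCompact K ∧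
    ∀ v, ∃ γ ∈ Γ, v - γ ∈ K := by
  have : Module.Finite ℤ Γ := ZLattice.module_finite ℝ Γ
  have : Module.Free ℤ Γ := ZLattice.module_free ℝ Γ
  let b := (Module.Free.chooseBasis ℤ Γ).ofZLatticeBasis ℝ
  have hb : Submodule.span ℤ (Set.range b) = Γ := Module.Basis.ofZLatticeBasis_span ..
  refine ⟨closure (ZSpan.fundamentalDomain b),
    (ZSpan.fundamentalDomain_isBounded b).isCompact_closure, fun v => ?_⟩
  refine ⟨ZSpan.floor b v, hb.le (ZSpan.floor b v).2, subset_closure ?_⟩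
  exact ZSpan.fract_mem_fundamentalDomain b v

end Lattice

section Comparison

variable {E H : Type*} [NormedAddCommGroup E] [NormedSpace ℝ E] [FiniteDimensional ℝ E]
  [NormedAddCommGroup H] [NormedSpace ℝ H] [FiniteDimensional ℝ H]
  {Γ : Submodule ℤ (E × H)} [DiscreteTopology Γ] [IsZLattice ℝ Γ]

theorem exists_forall_exists_dist_lt (hdense : Dense (Prod.snd '' (Γ : Set (E × H)))) {ε : ℝ}
    (hε : 0 < ε) : ∃ C : ℝ, ∀ v : E × H, ∃ γ ∈ Γ, dist v.1 γ.1 < C ∧ dist v.2 γ.2 < ε := by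
  obtain ⟨K, hK, hcover⟩ := exists_isCompact_forall_exists_sub_mem Γ
  let U : ℕ → Set (E × H) := fun n => ⋃ γ ∈ Γ, Metric.ball γ.1 n ×ˢ Metric.ball γ.2 ε
  have hopen : ∀ n, IsOpen (U n) := fun n =>
    isOpen_biUnion fun γ _ => Metric.isOpen_ball.prod Metric.isOpen_ball
  have hmono : Monotone U := fun n k hnk => by
    dsimp only [U]
    gcongr
  have hKU : K ⊆ ⋃ n, U n := fun v _ => by
    obtain ⟨_, ⟨γ, hγ, rfl⟩, hlt⟩ := hdense.exists_dist_lt v.2 hε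
    obtain ⟨n, hn⟩ := exists_nat_gt (dist v.1 γ.1)
    exact Set.mem_iUnion.2 ⟨n, Set.mem_biUnion hγ ⟨hn, hlt⟩⟩
  obtain ⟨n, hn⟩ := hK.elim_directed_cover U hopen hKU hmono.directed_le
  refine ⟨n, fun v => ?_⟩
  obtain ⟨δ, hδ, hv⟩ := hcover v
  obtain ⟨γ, hγ, h1, h2⟩ := Set.mem_iUnion₂.1 (hn hv)
  refine ⟨γ + δ, add_mem hγ hδ, ?_, ?_⟩
  · rwa [Metric.mem_ball, Prod.fst_sub, dist_eq_norm, sub_sub, add_comm, ← dist_eq_norm] at h1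
  · rwa [Metric.mem_ball, Prod.snd_sub, dist_eq_norm, sub_sub, add_comm, ← dist_eq_norm] at h2

variable [MeasurableSpace H] [BorelSpace H] {K S : Set H}

theorem exists_forall_internalMeasure_le (hdense : Dense (Prod.snd '' (Γ : Set (E × H))))
    (hK : IsCompact K) (hKS : K ⊆ interior S) : ∃ C : ℝ, ∀ φ φ' : E → ℝ≥0∞,
      (∀ y y', dist y y' < C → φ y ≤ φ' y') → ∀ v v' : E × H,
        internalMeasure Γ φ v.1 (v.2 +ᵥ K) ≤ internalMeasure Γ φ' v'.1 (v'.2 +ᵥ S) := by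
  obtain ⟨ε, hε, hKε⟩ := hK.exists_thickening_subset_open isOpen_interior hKS
  obtain ⟨C, hC⟩ := exists_forall_exists_dist_lt hdense hε
  refine ⟨C, fun φ φ' hφ v v' => ?_⟩
  obtain ⟨γ, hγ, h1, h2⟩ := hC (v' - v)
  rw [← internalMeasure_add_vadd ⟨γ, hγ⟩, internalMeasure_vadd, internalMeasure_vadd]
  refine ENNReal.tsum_le_tsum fun δ => mul_le_mul' (hφ _ _ ?_) ?_
  · rw [Prod.fst_sub, Prod.fst_sub, dist_sub_left, dist_comm]
    exact (dist_sub_eq_dist_add_left _ _ _).symm.trans_lt h1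
  · by_cases hmem : ((δ : E × H) - (γ.1 + v.1, γ.2 + v.2)).2 ∈ K
    · rw [Set.indicator_of_mem hmem, Set.indicator_of_mem]
      · rfl
      · refine interior_subset (hKε <| Metric.mem_thickening_iff.2 ⟨_, hmem, ?_⟩)
        rw [Prod.snd_sub, Prod.snd_sub, dist_sub_left]
        exact (dist_sub_eq_dist_add_left _ _ _).symm.trans_lt h2
    · rw [Set.indicator_of_notMem hmem]
      exact zero_le

variable [MeasurableSpace E] [BorelSpace E] {μ : Measure E} [μ.IsAddHaarMeasure] {ν : Measure H}
  [ν.IsAddHaarMeasure]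

theorem exists_forall_internalMeasure_mul_covolume_le
    (hdense : Dense (Prod.snd '' (Γ : Set (E × H)))) (hK : IsCompact K) (hS : MeasurableSet S)
    (hKS : K ⊆ interior S) : ∃ C : ℝ, ∀ φ φ' : E → ℝ≥0∞, Measurable φ' →
      (∀ y y', dist y y' < C → φ y ≤ φ' y') → ∀ x, internalMeasure Γ φ x K *
        ENNReal.ofReal (ZLattice.covolume Γ (μ.prod ν)) ≤ (∫⁻ y, φ' y ∂μ) * ν S := by
  obtain ⟨D, hD, hμD⟩ := exists_isAddFundamentalDomain Γ (μ.prod ν)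
  obtain ⟨C, hC⟩ := exists_forall_internalMeasure_le hdense hK hKS
  refine ⟨C, fun φ φ' hφ' hφ x => ?_⟩
  rw [← setLIntegral_internalMeasure hD hφ' hS, ← hμD, ← setLIntegral_const]
  refine lintegral_mono fun v => ?_
  simpa using hC φ φ' hφ (x, 0) v

theorem exists_forall_le_internalMeasure_mul_covolume
    (hdense : Dense (Prod.snd '' (Γ : Set (E × H)))) (hK : IsCompact K)
    (hKS : K ⊆ interior S) : ∃ C : ℝ, ∀ φ φ' : E → ℝ≥0∞, Measurable φ →
      (∀ y y', dist y y' < C → φ y ≤ φ' y') → ∀ x, (∫⁻ y, φ y ∂μ) * ν K ≤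
        internalMeasure Γ φ' x S * ENNReal.ofReal (ZLattice.covolume Γ (μ.prod ν)) := by
  obtain ⟨D, hD, hμD⟩ := exists_isAddFundamentalDomain Γ (μ.prod ν)
  obtain ⟨C, hC⟩ := exists_forall_internalMeasure_le hdense hK hKS
  refine ⟨C, fun φ φ' hφm hφ x => ?_⟩
  rw [← setLIntegral_internalMeasure hD hφm hK.measurableSet, ← hμD, ← setLIntegral_const]
  refine lintegral_mono fun v => ?_
  simpa using hC φ φ' hφ v (x, 0)

end Comparison

section Density

variable {m : ℕ}

theorem cube_eq_preimage (x : EuclideanSpace ℝ (Fin m)) (R : ℝ) :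
    cube x R = WithLp.ofLp ⁻¹' Set.Icc x.ofLp (fun i => x i + R) := by
  ext t
  simp [cube, Pi.le_def, forall_and]

theorem measurableSet_cube (x : EuclideanSpace ℝ (Fin m)) (R : ℝ) : MeasurableSet (cube x R) := by
  rw [cube_eq_preimage]
  exact (PiLp.volume_preserving_ofLp (Fin m)).measurable measurableSet_Icc

theorem volume_cube (x : EuclideanSpace ℝ (Fin m)) (R : ℝ) :
    volume (cube x R) = ENNReal.ofReal R ^ m := by
  rw [cube_eq_preimage, (PiLp.volume_preserving_ofLp (Fin m)).measure_preimage
    measurableSet_Icc.nullMeasurableSet, Real.volume_Icc_pi]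
  simp

theorem mem_cube_of_dist_lt {x t s : EuclideanSpace ℝ (Fin m)} {R C : ℝ} (ht : t ∈ cube x R)
    (hts : dist t s < C) : s ∈ cube (x - WithLp.toLp 2 fun _ => C) (R + 2 * C) := fun i => by
  have hi : |t i - s i| < C := by
    rw [← Real.norm_eq_abs, ← PiLp.sub_apply]
    exact (PiLp.norm_apply_le _ i).trans_lt (by rwa [← dist_eq_norm])
  have := abs_lt.1 hi
  have := ht i
  simp only [PiLp.sub_apply]
  constructor <;> linarith

theorem indicator_cube_le {x t s : EuclideanSpace ℝ (Fin m)} {R C : ℝ} (hts : dist t s < C) :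
    (cube x R).indicator (1 : EuclideanSpace ℝ (Fin m) → ℝ≥0∞) t ≤
      (cube (x - WithLp.toLp 2 fun _ => C) (R + 2 * C)).indicator 1 s := by
  refine Set.indicator_apply_le' (fun ht => ?_) fun _ => zero_le
  rw [Set.indicator_of_mem (mem_cube_of_dist_lt ht hts)]
  rfl

variable {H : Type*} [NormedAddCommGroup H] [MeasurableSpace H] [BorelSpace H]
  {Γ : Submodule ℤ (EuclideanSpace ℝ (Fin m) × H)} [Countable Γ] {Ω : Set H}

theorem internalMeasure_indicator_cube
    (hΓ : Set.InjOn Prod.fst (Γ : Set (EuclideanSpace ℝ (Fin m) × H)))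
    (x : EuclideanSpace ℝ (Fin m)) (R : ℝ) (S : Set H) :
    internalMeasure Γ ((cube 0 R).indicator 1) x S = (modelSet Γ S ∩ cube x R).encard := by
  have hmem : ∀ y, y - x ∈ cube 0 R ↔ y ∈ cube x R := fun y => by
    simp [cube, sub_nonneg, add_comm R]
  rw [internalMeasure_eq_tsum_modelSet hΓ, ← ENNReal.tsum_set_one,
    tsum_subtype _ fun y => (cube 0 R).indicator 1 (y - x), tsum_subtype _ fun _ => (1 : ℝ≥0∞),
    ← Set.indicator_indicator]
  refine tsum_congr fun y => congrArg (fun f => (modelSet Γ S).indicator f y) (funext fun y => ?_)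
  exact Set.indicator_eq_indicator (hmem y) rfl

theorem tendsto_ofReal_add_pow_div (C : ℝ) (m : ℕ) :
    Tendsto (fun R : ℝ => ENNReal.ofReal (R + C) ^ m / ENNReal.ofReal R ^ m) atTop (𝓝 1) := by
  have hlim : Tendsto (fun R : ℝ => (1 + C * R⁻¹) ^ m) atTop (𝓝 1) := by
    simpa using ((tendsto_inv_atTop_zero.const_mul C).const_add 1).pow m
  rw [← ENNReal.ofReal_one]
  refine (ENNReal.tendsto_ofReal hlim).congr' ?_
  filter_upwards [eventually_gt_atTop 0, eventually_ge_atTop (-C)] with R hR hRC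
  rw [← ENNReal.ofReal_pow (by linarith), ← ENNReal.ofReal_pow hR.le,
    ← ENNReal.ofReal_div_of_pos (by positivity), ← div_pow, add_div, div_self hR.ne',
    div_eq_mul_inv]

end Density

section ModelSetDensity

variable {m : ℕ} {H : Type*} [NormedAddCommGroup H] [NormedSpace ℝ H] [FiniteDimensional ℝ H]
  [MeasurableSpace H] [BorelSpace H] {ν : Measure H} [ν.IsAddHaarMeasure]
  {Γ : Submodule ℤ (EuclideanSpace ℝ (Fin m) × H)} [DiscreteTopology Γ] [IsZLattice ℝ Γ]
  {Ω K S : Set H}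

theorem exists_forall_encard_modelSet_mul_covolume_le
    (hΓ : Set.InjOn Prod.fst (Γ : Set (EuclideanSpace ℝ (Fin m) × H)))
    (hdense : Dense (Prod.snd '' (Γ : Set (EuclideanSpace ℝ (Fin m) × H))))
    (hK : IsCompact K) (hS : MeasurableSet S) (hKS : K ⊆ interior S) : ∃ C : ℝ, ∀ x R,
      ((modelSet Γ K ∩ cube x R).encard : ℝ≥0∞) *
          ENNReal.ofReal (ZLattice.covolume Γ (volume.prod ν)) ≤
        ENNReal.ofReal (R + C) ^ m * ν S := by
  obtain ⟨C, hC⟩ := exists_forall_internalMeasure_mul_covolume_le (μ := volume) (ν := ν)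
    hdense hK hS hKS
  refine ⟨2 * C, fun x R => ?_⟩
  have hcube := measurableSet_cube (0 - WithLp.toLp 2 fun _ : Fin m => C) (R + 2 * C)
  rw [← internalMeasure_indicator_cube hΓ, ← volume_cube, ← lintegral_indicator_one hcube]
  exact hC _ _ (measurable_one.indicator hcube) (fun y y' => indicator_cube_le) x

theorem exists_forall_le_encard_modelSet_mul_covolume
    (hΓ : Set.InjOn Prod.fst (Γ : Set (EuclideanSpace ℝ (Fin m) × H)))
    (hdense : Dense (Prod.snd '' (Γ : Set (EuclideanSpace ℝ (Fin m) × H))))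
    (hK : IsCompact K) (hKS : K ⊆ interior S) : ∃ C : ℝ, ∀ x R,
      ENNReal.ofReal (R + C) ^ m * ν K ≤ ((modelSet Γ S ∩ cube x R).encard : ℝ≥0∞) *
        ENNReal.ofReal (ZLattice.covolume Γ (volume.prod ν)) := by
  obtain ⟨C, hC⟩ := exists_forall_le_internalMeasure_mul_covolume (μ := volume) (ν := ν)
    hdense hK hKS
  refine ⟨-(2 * C), fun x R => ?_⟩
  have hcube := measurableSet_cube (WithLp.toLp 2 fun _ : Fin m => C) (R + -(2 * C))
  rw [← internalMeasure_indicator_cube hΓ, ← volume_cube, ← lintegral_indicator_one hcube]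
  refine hC _ _ (measurable_one.indicator hcube) (fun y y' hy => ?_) x
  simpa only [sub_self, neg_add_cancel_right] using
    indicator_cube_le (x := WithLp.toLp 2 fun _ => C) (R := R + -(2 * C)) hy

theorem eventually_lt_encard_modelSet
    (hΓ : Set.InjOn Prod.fst (Γ : Set (EuclideanSpace ℝ (Fin m) × H)))
    (hdense : Dense (Prod.snd '' (Γ : Set (EuclideanSpace ℝ (Fin m) × H))))
    (hΩν : ν (frontier Ω) = 0) (x : EuclideanSpace ℝ (Fin m)) {a : ℝ≥0∞} (ha : a < ν Ω) :
    ∀ᶠ R : ℝ in atTop, a < ((modelSet Γ Ω ∩ cube x R).encard : ℝ≥0∞) *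
      ENNReal.ofReal (ZLattice.covolume Γ (volume.prod ν)) / ENNReal.ofReal R ^ m := by
  rw [← measure_congr (interior_ae_eq_of_null_frontier hΩν)] at ha
  obtain ⟨K, hKΩ, hK, haK⟩ := isOpen_interior.exists_lt_isCompact ha
  obtain ⟨C, hC⟩ := exists_forall_le_encard_modelSet_mul_covolume (ν := ν) hΓ hdense hK hKΩ
  have hlim := ENNReal.Tendsto.mul_const (b := ν K) (tendsto_ofReal_add_pow_div C m)
    (Or.inl one_ne_zero)
  rw [one_mul] at hlim
  filter_upwards [hlim.eventually_const_lt haK] with R hR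
  calc a < ENNReal.ofReal (R + C) ^ m / ENNReal.ofReal R ^ m * ν K := hR
    _ = ENNReal.ofReal (R + C) ^ m * ν K / ENNReal.ofReal R ^ m := ENNReal.mul_div_right_comm.symm
    _ ≤ _ := ENNReal.div_le_div_right (hC x R) _

theorem eventually_encard_modelSet_lt
    (hΓ : Set.InjOn Prod.fst (Γ : Set (EuclideanSpace ℝ (Fin m) × H)))
    (hdense : Dense (Prod.snd '' (Γ : Set (EuclideanSpace ℝ (Fin m) × H))))
    (hΩ : IsCompact Ω) (x : EuclideanSpace ℝ (Fin m)) {a : ℝ≥0∞} (ha : ν Ω < a) :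
    ∀ᶠ R : ℝ in atTop, ((modelSet Γ Ω ∩ cube x R).encard : ℝ≥0∞) *
      ENNReal.ofReal (ZLattice.covolume Γ (volume.prod ν)) / ENNReal.ofReal R ^ m < a := by
  obtain ⟨U, hΩU, hU, hUa⟩ := Set.exists_isOpen_lt_of_lt _ _ ha
  obtain ⟨C, hC⟩ := exists_forall_encard_modelSet_mul_covolume_le (ν := ν) hΓ hdense hΩ
    hU.measurableSet (hU.interior_eq.symm ▸ hΩU)
  have hlim := ENNReal.Tendsto.mul_const (b := ν U) (tendsto_ofReal_add_pow_div C m)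
    (Or.inl one_ne_zero)
  rw [one_mul] at hlim
  filter_upwards [hlim.eventually_lt_const hUa] with R hR
  refine lt_of_le_of_lt ?_ hR
  rw [← ENNReal.mul_div_right_comm]
  exact ENNReal.div_le_div_right (hC x R) _

theorem hasDensity_modelSet
    (hΓ : Set.InjOn Prod.fst (Γ : Set (EuclideanSpace ℝ (Fin m) × H)))
    (hdense : Dense (Prod.snd '' (Γ : Set (EuclideanSpace ℝ (Fin m) × H))))
    (hΩ : IsCompact Ω) (hΩν : ν (frontier Ω) = 0) :
    HasDensity (modelSet Γ Ω) (ν.real Ω / ZLattice.covolume Γ (volume.prod ν)) := fun x => by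
  have hcov := ZLattice.covolume_pos Γ (volume.prod ν)
  have hlim : Tendsto (fun R : ℝ => ((modelSet Γ Ω ∩ cube x R).encard : ℝ≥0∞) *
      ENNReal.ofReal (ZLattice.covolume Γ (volume.prod ν)) / ENNReal.ofReal R ^ m) atTop
      (𝓝 (ν Ω)) :=
    tendsto_order.2 ⟨fun _ ha => eventually_lt_encard_modelSet hΓ hdense hΩν x ha,
      fun _ ha => eventually_encard_modelSet_lt hΓ hdense hΩ x ha⟩
  refine (((ENNReal.tendsto_toReal hΩ.measure_lt_top.ne).comp hlim).div_const _).congr' ?_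
  filter_upwards [eventually_ge_atTop 0] with R hR
  have hcard : (((modelSet Γ Ω ∩ cube x R).encard : ℝ≥0∞)).toReal =
      (modelSet Γ Ω ∩ cube x R).ncard := by
    rw [Set.ncard_def]
    cases (modelSet Γ Ω ∩ cube x R).encard <;> simp
  rw [Function.comp_apply, ENNReal.toReal_div, ENNReal.toReal_mul, ENNReal.toReal_pow,
    ENNReal.toReal_ofReal hR, ENNReal.toReal_ofReal hcov.le, hcard]
  field_simp

theorem HasDensity.density_eq {S : Set (EuclideanSpace ℝ (Fin m))} {d : ℝ} (hS : HasDensity S d) :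
    density S = d :=
  (hS 0).limUnder_eq

end ModelSetDensity

/-! ### Frame sums and the Fourier transform -/

section MeanValue

variable {E H : Type*} [NormedAddCommGroup E] [NormedSpace ℝ E] [FiniteDimensional ℝ E]
  [MeasurableSpace E] [BorelSpace E] [NormedAddCommGroup H] [NormedSpace ℝ H]
  [FiniteDimensional ℝ H] [MeasurableSpace H] [BorelSpace H]
  {μ : Measure E} [μ.IsAddHaarMeasure] {ν : Measure H} [ν.IsAddHaarMeasure]
  {Γ : Submodule ℤ (E × H)} [DiscreteTopology Γ] [IsZLattice ℝ Γ]

theorem ae_tsum_modelSet_eq_iff (hΓ : Set.InjOn Prod.fst (Γ : Set (E × H)))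
    (hdense : Dense (Prod.snd '' (Γ : Set (E × H)))) {Ω : Set H} (hΩ : IsCompact Ω)
    (hΩint : (interior Ω).Nonempty) (hΩν : ν (frontier Ω) = 0) {φ : E → ℝ≥0∞}
    (hφ : Measurable φ) {c : ℝ≥0∞} (hc : c ≠ ∞) (hle : ∀ x, ∑' y : modelSet Γ Ω, φ (y - x) ≤ c) :
    (∀ᵐ x ∂μ, ∑' y : modelSet Γ Ω, φ (y - x) = c) ↔
      ENNReal.ofReal (ν.real Ω / ZLattice.covolume Γ (μ.prod ν)) * ∫⁻ x, φ x ∂μ = c := by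
  obtain ⟨D, hD, hμD⟩ := exists_isAddFundamentalDomain Γ (μ.prod ν)
  have hcov := ZLattice.covolume_pos Γ (μ.prod ν)
  simp only [← internalMeasure_eq_tsum_modelSet hΓ] at hle ⊢
  rw [ae_internalMeasure_eq_iff hdense hΩ hΩint hΩν hD (by simp [hμD]) hφ hc hle, hμD,
    ENNReal.ofReal_div_of_pos hcov, ofReal_measureReal hΩ.measure_lt_top.ne,
    ← ENNReal.mul_div_right_comm, eq_comm (b := c), ENNReal.eq_div_iff (by simpa using hcov)
      ENNReal.ofReal_ne_top, mul_comm (ν Ω), mul_comm c, eq_comm]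

end MeanValue

section Frames

variable {ι V : Type*} [NormedAddCommGroup V] [InnerProductSpace ℂ V] {e : ι → V}

theorem isNormalizedTightFrame_iff :
    IsNormalizedTightFrame e ↔ IsBesselWith 1 e ∧ ∀ f, frameSum e f = ‖f‖ₑ ^ 2 := by
  simp only [IsNormalizedTightFrame, IsFrameWith, IsBesselWith, ENNReal.coe_one, one_mul,
    zero_lt_one, true_and, forall_and, le_antisymm_iff]
  tauto

-- `frameSum e f ^ (1 / 2)` is the `ℓ²` norm of the coefficients of `f`, extended by `∞`.
theorem frameSum_add_rpow_half_le (f h : V) :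
    frameSum e (f + h) ^ (1 / 2 : ℝ) ≤ frameSum e f ^ (1 / 2 : ℝ) + frameSum e h ^ (1 / 2 : ℝ) := by
  let _ : MeasurableSpace ι := ⊤
  have hnorm : ∀ k : V, frameSum e k ^ (1 / 2 : ℝ) =
      eLpNorm (fun i => inner ℂ (e i) k) 2 Measure.count := fun k => by
    rw [eLpNorm_eq_lintegral_rpow_enorm_toReal two_ne_zero ENNReal.ofNat_ne_top, lintegral_count]
    simp [frameSum]
  have hmeas : ∀ k : V, AEStronglyMeasurable (fun i => inner ℂ (e i) k) Measure.count := fun k =>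
    measurable_from_top.aestronglyMeasurable
  simp only [hnorm, inner_add_right]
  exact eLpNorm_add_le (hmeas f) (hmeas h) one_le_two

theorem IsBesselWith.continuous_frameSum {B : ℝ≥0} (he : IsBesselWith B e) :
    Continuous (frameSum e) := by
  have hbound : ∀ f, frameSum e f ^ (1 / 2 : ℝ) ≤ (B : ℝ≥0∞) ^ (1 / 2 : ℝ) * ‖f‖ₑ := fun f => by
    calc frameSum e f ^ (1 / 2 : ℝ) ≤ (B * ‖f‖ₑ ^ (2 : ℝ)) ^ (1 / 2 : ℝ) := by
          gcongr
          exact_mod_cast he f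
      _ = (B : ℝ≥0∞) ^ (1 / 2 : ℝ) * ‖f‖ₑ := by
          rw [ENNReal.mul_rpow_of_nonneg _ _ (by positivity), ← ENNReal.rpow_mul]
          norm_num
  have hcont : Continuous fun f => frameSum e f ^ (1 / 2 : ℝ) := by
    refine continuous_of_le_add_edist ((B : ℝ≥0∞) ^ (1 / 2 : ℝ)) (by finiteness) fun f h => ?_
    calc frameSum e f ^ (1 / 2 : ℝ) = frameSum e (h + (f - h)) ^ (1 / 2 : ℝ) := by
          rw [add_sub_cancel]
      _ ≤ frameSum e h ^ (1 / 2 : ℝ) + frameSum e (f - h) ^ (1 / 2 : ℝ) :=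
          frameSum_add_rpow_half_le _ _
      _ ≤ frameSum e h ^ (1 / 2 : ℝ) + (B : ℝ≥0∞) ^ (1 / 2 : ℝ) * edist f h := by
          rw [edist_eq_enorm_sub]
          gcongr
          exact hbound _
  refine ((ENNReal.continuous_rpow_const (y := 2)).comp hcont).congr fun f => ?_
  rw [Function.comp_apply, ← ENNReal.rpow_mul]
  norm_num

end Frames

section Lp

variable {α E : Type*} [MeasurableSpace α] {μ : Measure α} [NormedAddCommGroup E]

theorem enorm_sq_eq_lintegral (f : Lp E 2 μ) : ‖f‖ₑ ^ 2 = ∫⁻ x, ‖f x‖ₑ ^ 2 ∂μ := by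
  rw [Lp.enorm_def]
  simpa using eLpNorm_nnreal_pow_eq_lintegral (p := 2) (f := f) (μ := μ) two_ne_zero

theorem forall_lintegral_mul_eq_iff [SigmaFinite μ] {G : α → ℝ≥0∞} (hG : Measurable G) :
    (∀ f : Lp ℂ 2 μ, ∫⁻ x, ‖f x‖ₑ ^ 2 * G x ∂μ = ‖f‖ₑ ^ 2) ↔ ∀ᵐ x ∂μ, G x = 1 := by
  refine ⟨fun h => ?_, fun h f => ?_⟩
  · refine ae_eq_of_forall_setLIntegral_eq_of_sigmaFinite hG measurable_one fun S hS hSfin => ?_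
    have hind : ∀ᵐ x ∂μ, ‖indicatorConstLp 2 hS hSfin.ne (1 : ℂ) x‖ₑ ^ 2 = S.indicator 1 x := by
      filter_upwards [indicatorConstLp_coeFn (p := 2) (hs := hS) (hμs := hSfin.ne) (c := (1 : ℂ))]
        with x hx
      by_cases hxS : x ∈ S <;> simp [hx, hxS]
    have hmul : ∀ᵐ x ∂μ, ‖indicatorConstLp 2 hS hSfin.ne (1 : ℂ) x‖ₑ ^ 2 * G x =
        S.indicator G x := by
      filter_upwards [hind] with x hx
      by_cases hxS : x ∈ S <;> simp [hx, hxS]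
    have hS1 := h (indicatorConstLp 2 hS hSfin.ne 1)
    rwa [enorm_sq_eq_lintegral, lintegral_congr_ae hmul, lintegral_congr_ae hind,
      lintegral_indicator hS, lintegral_indicator hS] at hS1
  · rw [enorm_sq_eq_lintegral]
    refine lintegral_congr_ae ?_
    filter_upwards [h] with x hx
    rw [hx, mul_one]

end Lp

section Fourier

variable {V E : Type*} [NormedAddCommGroup V] [InnerProductSpace ℝ V] [FiniteDimensional ℝ V]
  [MeasurableSpace V] [BorelSpace V] [NormedAddCommGroup E]

theorem continuous_fourier_of_integrable [NormedSpace ℂ E] {F : V → E} (hF : Integrable F) :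
    Continuous (𝓕 F) :=
  VectorFourier.fourierIntegral_continuous Real.continuous_fourierChar
    (by exact continuous_inner) hF

theorem fourier_comp_sub_right [NormedSpace ℂ E] (F : V → E) (x w : V) :
    𝓕 (fun t => F (t - x)) w = Real.fourierChar (-inner ℝ x w) • 𝓕 F w := by
  have h := congrFun (VectorFourier.fourierIntegral_comp_add_right Real.fourierChar volume
    (innerₗ V) F (-x)) w
  simpa only [Function.comp_def, ← sub_eq_add_neg, innerₗ_apply_apply, inner_neg_left] using! h

theorem fourier_fourierChar_smul [NormedSpace ℂ E] (F : V → E) (b w : V) :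
    𝓕 (fun t => Real.fourierChar (inner ℝ b t) • F t) w = 𝓕 F (w - b) := by
  simp only [Real.fourier_eq, ← mul_smul, ← AddChar.map_add_eq_mul, inner_sub_right, neg_sub,
    real_inner_comm b, neg_add_eq_sub]

variable [InnerProductSpace ℂ E] [CompleteSpace E]

theorem coeFn_fourier_ae_eq {F : Lp E 2 (volume : Measure V)} (hF : Integrable F) :
    (𝓕 F : Lp E 2 (volume : Measure V)) =ᵐ[volume] 𝓕 (F : V → E) := by
  refine ae_eq_of_integral_contDiff_smul_eq ((Lp.memLp (𝓕 F)).locallyIntegrable one_le_two)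
    (continuous_fourier_of_integrable hF).locallyIntegrable fun φ hφ hφc => ?_
  have hφc' : HasCompactSupport (Complex.ofRealCLM ∘ φ) := hφc.comp_left rfl
  have hφ' : ContDiff ℝ ((⊤ : ℕ∞) : WithTop ℕ∞) (Complex.ofRealCLM ∘ φ) := by fun_prop
  let ψ := hφc'.toSchwartzMap hφ'
  have hdual := DFunLike.congr_fun (Lp.fourier_toTemperedDistribution_eq F) ψ
  have hflip : ∫ x, 𝓕 (ψ : V → ℂ) x • F x = ∫ x, ψ x • 𝓕 (F : V → E) x := by
    simpa using! VectorFourier.integral_fourierIntegral_smul_eq_flip (L := innerₗ V)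
      Real.continuous_fourierChar continuous_inner (ψ.integrable (μ := volume)) hF
  simp only [TemperedDistribution.fourier_apply, Lp.toTemperedDistribution_apply,
    SchwartzMap.fourier_coe] at hdual
  simpa [ψ] using hdual.symm.trans hflip

theorem fourier_surjective :
    Function.Surjective fun F : Lp E 2 (volume : Measure V) => (𝓕 F : Lp E 2 volume) :=
  fun F => ⟨𝓕⁻ F, FourierTransform.fourier_fourierInv_eq F⟩

theorem enorm_fourier (F : Lp E 2 (volume : Measure V)) : ‖𝓕 F‖ₑ = ‖F‖ₑ := by
  rw [← ofReal_norm, ← ofReal_norm, Lp.norm_fourier_eq]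

theorem memLp_fourier {F : Lp E 2 (volume : Measure V)} (hF : Integrable F) :
    MemLp (𝓕 (F : V → E)) 2 :=
  (Lp.memLp (𝓕 F)).ae_eq (coeFn_fourier_ae_eq hF)

theorem lintegral_enorm_fourier_sq {F : V → E} (h1 : Integrable F) (h2 : MemLp F 2) :
    ∫⁻ w, ‖𝓕 F w‖ₑ ^ 2 = ∫⁻ x, ‖F x‖ₑ ^ 2 := by
  have hint : Integrable (h2.toLp F) := h1.congr h2.coeFn_toLp.symm
  have hfourier : ∀ᵐ w, ‖𝓕 F w‖ₑ ^ 2 =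
      ‖(𝓕 (h2.toLp F) : Lp E 2 (volume : Measure V)) w‖ₑ ^ 2 := by
    filter_upwards [coeFn_fourier_ae_eq hint] with w hw
    rw [hw, Real.fourier_congr_ae h2.coeFn_toLp]
  have hcoe : ∀ᵐ x, ‖F x‖ₑ ^ 2 = ‖h2.toLp F x‖ₑ ^ 2 := by
    filter_upwards [h2.coeFn_toLp] with x hx
    rw [hx]
  rw [lintegral_congr_ae hfourier, lintegral_congr_ae hcoe, ← enorm_sq_eq_lintegral,
    ← enorm_sq_eq_lintegral, enorm_fourier]

theorem lintegral_enorm_fourierInv_sq {F : V → E} (h1 : Integrable F) (h2 : MemLp F 2) :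
    ∫⁻ x, ‖𝓕⁻ F x‖ₑ ^ 2 = ∫⁻ w, ‖F w‖ₑ ^ 2 := by
  simp_rw [Real.fourierInv_eq_fourier_neg]
  rw [← lintegral_enorm_fourier_sq h1 h2,
    lintegral_neg_eq_self (fun w => ‖𝓕 F w‖ₑ ^ 2)]

end Fourier

section TimeFrequencyShifts

variable {m : ℕ}

theorem coeFn_translateL2 (x : EuclideanSpace ℝ (Fin m)) (f : L2 m) :
    translateL2 x f =ᵐ[volume] fun t => f (t - x) :=
  Lp.coeFn_compMeasurePreserving f (measurePreserving_sub_right volume x)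

theorem translateL2_zero (f : L2 m) : translateL2 0 f = f := by
  apply Lp.ext
  filter_upwards [coeFn_translateL2 0 f] with t ht
  rw [ht, sub_zero]

theorem enorm_translateL2 (x : EuclideanSpace ℝ (Fin m)) (f : L2 m) :
    ‖translateL2 x f‖ₑ = ‖f‖ₑ := by
  rw [← ofReal_norm, ← ofReal_norm]
  exact congrArg _ (Lp.norm_compMeasurePreserving f (measurePreserving_sub_right volume x))

theorem continuous_translateL2 (f : L2 m) : Continuous fun x => translateL2 x f := by
  let shift : C(EuclideanSpace ℝ (Fin m), C(EuclideanSpace ℝ (Fin m), EuclideanSpace ℝ (Fin m))) :=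
    ContinuousMap.curry ⟨fun p => p.2 - p.1, by fun_prop⟩
  exact (continuous_const (y := f)).compMeasurePreservingLp shift.continuous
    (measurePreserving_sub_right volume) ENNReal.ofNat_ne_top

theorem inner_translateL2_translateL2 (x y : EuclideanSpace ℝ (Fin m)) (h f : L2 m) :
    inner ℂ (translateL2 y h) (translateL2 x f) = inner ℂ (translateL2 (y - x) h) f := by
  rw [L2.inner_def, L2.inner_def,
    ← integral_sub_right_eq_self (fun t => inner ℂ (translateL2 (y - x) h t) (f t)) x]
  refine integral_congr_ae ?_
  have hshift := (measurePreserving_sub_right volume x).quasiMeasurePreserving.ae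
    (coeFn_translateL2 (y - x) h)
  filter_upwards [coeFn_translateL2 y h, coeFn_translateL2 x f, hshift] with t hy hx hyx
  rw [hy, hx, hyx, sub_sub_sub_cancel_right t y x]

theorem integrable_translateL2 (x : EuclideanSpace ℝ (Fin m)) {h : L2 m} (hh : Integrable h) :
    Integrable (translateL2 x h) :=
  (hh.comp_sub_right x).congr (coeFn_translateL2 x h).symm

theorem fourier_translateL2 (x : EuclideanSpace ℝ (Fin m)) (h : L2 m)
    (w : EuclideanSpace ℝ (Fin m)) :
    𝓕 (translateL2 x h : EuclideanSpace ℝ (Fin m) → ℂ) w =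
      Real.fourierChar (-inner ℝ x w) • 𝓕 (h : EuclideanSpace ℝ (Fin m) → ℂ) w := by
  rw [Real.fourier_congr_ae (coeFn_translateL2 x h), fourier_comp_sub_right]

theorem coeFn_modulateL2 (b : EuclideanSpace ℝ (Fin m)) (f : L2 m) :
    modulateL2 b f =ᵐ[volume] fun t => Real.fourierChar (inner ℝ b t) • f t := by
  filter_upwards [(memLp_modulate b f).coeFn_toLp] with t ht
  rw [modulateL2, ht, Circle.smul_def, Real.fourierChar_apply, smul_eq_mul]
  push_cast
  ring_nf

theorem integrable_modulateL2 (b : EuclideanSpace ℝ (Fin m)) {f : L2 m} (hf : Integrable f) :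
    Integrable (modulateL2 b f) := by
  refine hf.mono (Lp.aestronglyMeasurable _) ?_
  filter_upwards [coeFn_modulateL2 b f] with t ht
  rw [ht, Circle.norm_smul]

theorem fourier_modulateL2 (b : EuclideanSpace ℝ (Fin m)) (f : L2 m)
    (w : EuclideanSpace ℝ (Fin m)) :
    𝓕 (modulateL2 b f : EuclideanSpace ℝ (Fin m) → ℂ) w =
      𝓕 (f : EuclideanSpace ℝ (Fin m) → ℂ) (w - b) := by
  rw [Real.fourier_congr_ae (coeFn_modulateL2 b f), fourier_fourierChar_smul]

theorem inner_translateL2_eq_fourierInv (x : EuclideanSpace ℝ (Fin m)) {h : L2 m}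
    (hh : Integrable h) (f : L2 m) :
    inner ℂ (translateL2 x h) f =
      𝓕⁻ (fun w => inner ℂ (𝓕 (h : EuclideanSpace ℝ (Fin m) → ℂ) w) ((𝓕 f : L2 m) w)) x := by
  rw [← Lp.inner_fourier_eq, L2.inner_def, Real.fourierInv_eq]
  refine integral_congr_ae ?_
  filter_upwards [coeFn_fourier_ae_eq (integrable_translateL2 x hh)] with w hw
  rw [hw, fourier_translateL2, real_inner_comm, Circle.smul_def, Circle.smul_def, inner_smul_left,
    ← Circle.coe_inv_eq_conj, ← AddChar.map_neg_eq_inv, neg_neg, smul_eq_mul]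

theorem lintegral_inner_translateL2_sq {h : L2 m} (hh : Integrable h) (f : L2 m) :
    ∫⁻ x, ‖inner ℂ (translateL2 x h) f‖ₑ ^ 2 =
      ∫⁻ w, ‖(𝓕 f : L2 m) w‖ₑ ^ 2 * ‖𝓕 (h : EuclideanSpace ℝ (Fin m) → ℂ) w‖ₑ ^ 2 := by
  have hint : Integrable fun w =>
      inner ℂ (𝓕 (h : EuclideanSpace ℝ (Fin m) → ℂ) w) ((𝓕 f : L2 m) w) := by
    simpa only [RCLike.inner_apply'] using! (memLp_fourier hh).star.integrable_mul (Lp.memLp (𝓕 f))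
  have hmemLp : MemLp (fun w =>
      inner ℂ (𝓕 (h : EuclideanSpace ℝ (Fin m) → ℂ) w) ((𝓕 f : L2 m) w)) 2 :=
    (Lp.memLp (𝓕 f)).of_le_mul (c := ∫ t, ‖h t‖) hint.aestronglyMeasurable <|
      .of_forall fun w => (norm_inner_le_norm _ _).trans <| by
        gcongr
        exact VectorFourier.norm_fourierIntegral_le_integral_norm _ _ _ _ _
  simp_rw [inner_translateL2_eq_fourierInv _ hh]
  rw [lintegral_enorm_fourierInv_sq hint hmemLp]
  simp_rw [RCLike.inner_apply, enorm_mul, RCLike.enorm_conj, mul_pow]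

end TimeFrequencyShifts

section Amalgam

variable {m : ℕ}

theorem MemAmalgam.integrable {p : ℝ≥0∞} (hp : 1 ≤ p) {f : EuclideanSpace ℝ (Fin m) → ℂ}
    (hf : MemAmalgam p f) : Integrable f := by
  refine ⟨hf.1, ?_⟩
  have hcover : ⋃ k : Fin m → ℤ, cube (intVec k) 1 = Set.univ := by
    refine Set.eq_univ_of_forall fun t => Set.mem_iUnion.2 ⟨fun i => ⌊t i⌋, fun i => ?_⟩
    exact ⟨Int.floor_le _, (Int.lt_floor_add_one _).le⟩
  calc ∫⁻ t, ‖f t‖ₑ = ∫⁻ t in ⋃ k : Fin m → ℤ, cube (intVec k) 1, ‖f t‖ₑ := by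
        rw [hcover, Measure.restrict_univ]
    _ ≤ ∑' k : Fin m → ℤ, ∫⁻ t in cube (intVec k) 1, ‖f t‖ₑ := lintegral_iUnion_le _ _
    _ ≤ amalgamNorm p f := by
        refine ENNReal.tsum_le_tsum fun k => ?_
        rw [eLpNorm_indicator_eq_eLpNorm_restrict (measurableSet_cube _ _),
          ← eLpNorm_one_eq_lintegral_enorm]
        simpa [volume_cube] using eLpNorm_le_eLpNorm_mul_rpow_measure_univ
          (μ := volume.restrict (cube (intVec k) 1)) hp hf.1.restrict
    _ < ∞ := hf.2

theorem IsUniformlyDiscrete.countable {S : Set (EuclideanSpace ℝ (Fin m))}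
    (hS : IsUniformlyDiscrete S) : S.Countable := by
  obtain ⟨r, hr, hS⟩ := hS
  refine Set.PairwiseDisjoint.countable_of_isOpen (s := fun x => Metric.ball x (r / 2))
    (fun x hx y hy hxy => Metric.ball_disjoint_ball ?_) (fun _ _ => Metric.isOpen_ball)
    fun x _ => ⟨x, Metric.mem_ball_self (by positivity)⟩
  rw [add_halves]
  exact not_lt.1 fun hlt => hxy (hS x hx y hy hlt)

end Amalgam

/-! ### Tight frames of translates and Gabor systems -/

section TranslationSystems

variable {m : ℕ} {ι H : Type*}

/-- The system of all translates `T_x (h i)`, `x ∈ S`, of the generators `h i`. -/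
noncomputable def translationSystem (S : Set (EuclideanSpace ℝ (Fin m))) (h : ι → L2 m) :
    ι × S → L2 m :=
  fun i => translateL2 i.2 (h i.1)

theorem frameSum_translationSystem (S : Set (EuclideanSpace ℝ (Fin m))) (h : ι → L2 m)
    (x : EuclideanSpace ℝ (Fin m)) (f : L2 m) :
    frameSum (translationSystem S h) (translateL2 x f) =
      ∑' y : S, frameSum (fun i => translateL2 (y.1 - x) (h i)) f := by
  simp only [frameSum, translationSystem, inner_translateL2_translateL2]
  rw [ENNReal.tsum_prod', ENNReal.tsum_comm]

theorem measurable_inner_translateL2_sq (h f : L2 m) :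
    Measurable fun x => ‖inner ℂ (translateL2 x h) f‖ₑ ^ 2 :=
  ((continuous_translateL2 h).inner continuous_const).enorm.measurable.pow_const 2

theorem measurable_enorm_fourier_sq {h : L2 m} (hh : Integrable h) :
    Measurable fun t => ‖𝓕 (h : EuclideanSpace ℝ (Fin m) → ℂ) t‖ₑ ^ 2 :=
  (continuous_fourier_of_integrable hh).enorm.measurable.pow_const 2

theorem measurable_frameSum_translateL2 [Countable ι] (h : ι → L2 m) (f : L2 m) :
    Measurable fun x => frameSum (fun i => translateL2 x (h i)) f :=
  .tsum fun i => measurable_inner_translateL2_sq (h i) f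

theorem lintegral_frameSum_translateL2 [Countable ι] {h : ι → L2 m}
    (hh : ∀ i, Integrable (h i)) (f : L2 m) :
    ∫⁻ x, frameSum (fun i => translateL2 x (h i)) f =
      ∫⁻ t, ‖(𝓕 f : L2 m) t‖ₑ ^ 2 *
        ∑' i, ‖𝓕 (h i : EuclideanSpace ℝ (Fin m) → ℂ) t‖ₑ ^ 2 := by
  have hmeas : ∀ i, AEMeasurable fun t =>
      ‖(𝓕 f : L2 m) t‖ₑ ^ 2 * ‖𝓕 (h i : EuclideanSpace ℝ (Fin m) → ℂ) t‖ₑ ^ 2 := fun i =>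
    ((Lp.aestronglyMeasurable _).enorm.pow_const 2).mul
      (measurable_enorm_fourier_sq (hh i)).aemeasurable
  simp only [frameSum, ← ENNReal.tsum_mul_left]
  rw [lintegral_tsum fun i => (measurable_inner_translateL2_sq (h i) f).aemeasurable,
    lintegral_tsum hmeas]
  exact tsum_congr fun i => lintegral_inner_translateL2_sq (hh i) f

theorem IsBesselWith.frameSum_eq_iff_ae_translateL2 {B : ℝ≥0} {e : ι → L2 m}
    (he : IsBesselWith B e) :
    (∀ f, frameSum e f = ‖f‖ₑ ^ 2) ↔
      ∀ f, ∀ᵐ x, frameSum e (translateL2 x f) = ‖f‖ₑ ^ 2 := by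
  refine ⟨fun h f => .of_forall fun x => (h _).trans (by rw [enorm_translateL2]), fun h f => ?_⟩
  have hcont : Continuous fun x => frameSum e (translateL2 x f) :=
    he.continuous_frameSum.comp (continuous_translateL2 f)
  simpa only [translateL2_zero] using
    congrFun ((hcont.ae_eq_iff_eq volume continuous_const).1 (h f)) 0

variable [NormedAddCommGroup H] [NormedSpace ℝ H] [FiniteDimensional ℝ H] [MeasurableSpace H]
  [BorelSpace H] {ν : Measure H} [ν.IsAddHaarMeasure]
  {Γ : Submodule ℤ (EuclideanSpace ℝ (Fin m) × H)} [DiscreteTopology Γ] [IsZLattice ℝ Γ]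

theorem isNormalizedTightFrame_translationSystem_iff [Countable ι]
    (hΓ : Set.InjOn Prod.fst (Γ : Set (EuclideanSpace ℝ (Fin m) × H)))
    (hdense : Dense (Prod.snd '' (Γ : Set (EuclideanSpace ℝ (Fin m) × H)))) {Ω : Set H}
    (hΩ : IsCompact Ω) (hΩint : (interior Ω).Nonempty) (hΩν : ν (frontier Ω) = 0) {h : ι → L2 m}
    (hh : ∀ i, Integrable (h i)) :
    IsNormalizedTightFrame (translationSystem (modelSet Γ Ω) h) ↔
      IsBesselWith 1 (translationSystem (modelSet Γ Ω) h) ∧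
        ∀ᵐ t, ENNReal.ofReal (ν.real Ω / ZLattice.covolume Γ (volume.prod ν)) *
          ∑' i, ‖𝓕 (h i : EuclideanSpace ℝ (Fin m) → ℂ) t‖ₑ ^ 2 = 1 := by
  rw [isNormalizedTightFrame_iff]
  refine and_congr_right fun hB => ?_
  have hle : ∀ f x, ∑' y : modelSet Γ Ω, frameSum (fun i => translateL2 (y.1 - x) (h i)) f ≤
      ‖f‖ₑ ^ 2 := fun f x => by
    rw [← frameSum_translationSystem, ← enorm_translateL2 x f, ← one_mul (‖_‖ₑ ^ 2)]
    exact hB _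
  have hmeas : Measurable fun t => ∑' i, ‖𝓕 (h i : EuclideanSpace ℝ (Fin m) → ℂ) t‖ₑ ^ 2 :=
    .tsum fun i => measurable_enorm_fourier_sq (hh i)
  rw [hB.frameSum_eq_iff_ae_translateL2]
  refine Iff.trans (forall_congr' fun f => ?_) <| fourier_surjective.forall.symm.trans <|
    forall_lintegral_mul_eq_iff (hmeas.const_mul _)
  simp only [frameSum_translationSystem, enorm_fourier, mul_left_comm (‖_‖ₑ ^ 2)]
  rw [ae_tsum_modelSet_eq_iff hΓ hdense hΩ hΩint hΩν (measurable_frameSum_translateL2 h f)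
    (by finiteness) (hle f), lintegral_frameSum_translateL2 hh,
    lintegral_const_mul' _ _ ENNReal.ofReal_ne_top]

end TranslationSystems

section Gabor

variable {m L : ℕ}

theorem frameSum_gaborSystem (g : Fin L → L2 m) (S Δ : Set (EuclideanSpace ℝ (Fin m)))
    (f : L2 m) :
    frameSum (gaborSystem g S Δ) f =
      frameSum (translationSystem S fun p : Fin L × Δ => modulateL2 p.2 (g p.1)) f := by
  simp only [frameSum, gaborSystem, translationSystem, ENNReal.tsum_prod']
  exact tsum_congr fun l => ENNReal.tsum_comm

theorem isBesselWith_gaborSystem_iff {B : ℝ≥0} {g : Fin L → L2 m}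
    {S Δ : Set (EuclideanSpace ℝ (Fin m))} :
    IsBesselWith B (gaborSystem g S Δ) ↔
      IsBesselWith B (translationSystem S fun p : Fin L × Δ => modulateL2 p.2 (g p.1)) := by
  simp only [IsBesselWith, frameSum_gaborSystem]

theorem isNormalizedTightFrame_gaborSystem_iff {g : Fin L → L2 m}
    {S Δ : Set (EuclideanSpace ℝ (Fin m))} :
    IsNormalizedTightFrame (gaborSystem g S Δ) ↔
      IsNormalizedTightFrame
        (translationSystem S fun p : Fin L × Δ => modulateL2 p.2 (g p.1)) := by
  simp only [isNormalizedTightFrame_iff, isBesselWith_gaborSystem_iff, frameSum_gaborSystem]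

theorem tsum_enorm_fourier_modulateL2_sq (g : Fin L → L2 m) (Δ : Set (EuclideanSpace ℝ (Fin m)))
    (t : EuclideanSpace ℝ (Fin m)) :
    ∑' p : Fin L × Δ,
        ‖𝓕 (modulateL2 p.2 (g p.1) : EuclideanSpace ℝ (Fin m) → ℂ) t‖ₑ ^ 2 =
      ∑ l : Fin L, ∑' b : Δ, ‖𝓕 (g l : EuclideanSpace ℝ (Fin m) → ℂ) (t - b)‖ₑ ^ 2 := by
  simp only [fourier_modulateL2, ENNReal.tsum_prod', tsum_fintype]

end Gabor

end GaborModelSet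

open GaborModelSet in
theorem corollary5p2_general {m L : ℕ} {H : Type*} [NormedAddCommGroup H] [NormedSpace ℝ H]
    [FiniteDimensional ℝ H] [MeasurableSpace H] [BorelSpace H] (ν : Measure H) [ν.IsAddHaarMeasure]
    (Γ : Submodule ℤ (EuclideanSpace ℝ (Fin m) × H)) [DiscreteTopology Γ] [IsZLattice ℝ Γ]
    (hΓ : Set.InjOn Prod.fst (Γ : Set (EuclideanSpace ℝ (Fin m) × H)))
    (hdense : Dense (Prod.snd '' (Γ : Set (EuclideanSpace ℝ (Fin m) × H))))
    (Ω : Set H) (hΩ : IsCompact Ω) (hΩint : (interior Ω).Nonempty) (hΩν : ν (frontier Ω) = 0)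
    (Δ : Set (EuclideanSpace ℝ (Fin m))) (hΔ : Δ.Countable)
    (g : Fin L → L2 m) (hg : ∀ l, Integrable (g l)) :
    HasDensity (modelSet Γ Ω) (density (modelSet Γ Ω)) ∧
      (IsNormalizedTightFrame (gaborSystem g (modelSet Γ Ω) Δ) ↔
        IsBesselWith 1 (gaborSystem g (modelSet Γ Ω) Δ) ∧
          ∀ᵐ t : EuclideanSpace ℝ (Fin m), ENNReal.ofReal (density (modelSet Γ Ω)) *
            ∑ l : Fin L, ∑' b : Δ, ‖𝓕 (g l : EuclideanSpace ℝ (Fin m) → ℂ) (t - b)‖ₑ ^ 2 = 1) := by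
  have hdens := hasDensity_modelSet hΓ hdense hΩ hΩν
  have := hΔ.to_subtype
  have hint : ∀ p : Fin L × Δ, Integrable (modulateL2 p.2 (g p.1)) :=
    fun p => integrable_modulateL2 _ (hg p.1)
  rw [hdens.density_eq, isNormalizedTightFrame_gaborSystem_iff, isBesselWith_gaborSystem_iff]
  simp only [← tsum_enorm_fourier_modulateL2_sq]
  exact ⟨hdens, isNormalizedTightFrame_translationSystem_iff hΓ hdense hΩ hΩint hΩν hint⟩

theorem corollary5p2 {m L : ℕ}
    (Γ : Submodule ℤ (EuclideanSpace ℝ (Fin m) × ℝ)) [DiscreteTopology Γ] [IsZLattice ℝ Γ]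
    (Ω : Set ℝ) (hΓΩ : GaborModelSet.IsSimpleGenericSymmetric Γ Ω)
    (Δ : Set (EuclideanSpace ℝ (Fin m)))
    (hΔd : GaborModelSet.IsRelativelyDense Δ) (hΔu : GaborModelSet.IsUniformlyDiscrete Δ)
    (g : Fin L → GaborModelSet.L2 m) (hg : ∀ l, GaborModelSet.MemAmalgam 2 (g l)) :
    GaborModelSet.HasDensity (GaborModelSet.modelSet Γ Ω)
        (GaborModelSet.density (GaborModelSet.modelSet Γ Ω)) ∧
      (GaborModelSet.IsNormalizedTightFrame
          (GaborModelSet.gaborSystem g (GaborModelSet.modelSet Γ Ω) Δ) ↔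
        GaborModelSet.IsBesselWith 1
            (GaborModelSet.gaborSystem g (GaborModelSet.modelSet Γ Ω) Δ) ∧
          ∀ᵐ t : EuclideanSpace ℝ (Fin m),
            ENNReal.ofReal (GaborModelSet.density (GaborModelSet.modelSet Γ Ω)) *
              ∑ l : Fin L, ∑' b : Δ,
                ‖𝓕 (g l : EuclideanSpace ℝ (Fin m) → ℂ) (t - (b : EuclideanSpace ℝ (Fin m)))‖ₑ ^ 2
              = 1) := by
  have hΓ := hΓΩ.isCutAndProject
  have hΩ := hΓΩ.isWindow
  have hΩint : (interior Ω).Nonempty := closure_nonempty_iff.1 (by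
    rw [hΩ.closure_interior]
    exact hΩ.nonempty)
  exact corollary5p2_general volume Γ hΓ.injOn_fst hΓ.dense_snd Ω hΩ.isCompact hΩint
    hΩ.volume_frontier Δ hΔu.countable g fun l => (hg l).integrable one_le_two
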